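/- Let $M\subset\mathbb R^m$ be a nonempty compact $C^\infty$ embedded submanifold without boundary, of dimension $n$, with Riemannian volume measure $dV_M$ (the $n$-dimensional Hausdorff measure on $M$). For a real polynomial $p$ in $m$ variables and $x\in M$ let $\nabla_t p(x)$ be the tangential gradient, i.e. the orthogonal projection of $\nabla p(x)$ onto the tangent space $T_xM$. Suppose that for some $q\in[1,\infty]$ there is a constant $C>0$ such that \[ \|\nabla_t p\|_{L^q(M,dV_M)}\le C\,\deg(p)\,\|p\|_{L^q(M,dV_M)} \] for all real polynomials $p$ in $m$ variables, where $\deg$ is the total degree. Then $M$ is algebraic, in the sense that the Zariski closure of $M$ in $\mathbb R^m$ (the common zero set of all real polynomials vanishing on $M$) is a real algebraic set of dimension $n=\dim M$, the dimension of a real algebraic set $V$ being the Krull dimension of $\mathbb R[x_1,\dots,x_m]/I(V)$, where $I(V)$ is the ideal of all polynomials that vanish on $V$. -/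

import Mathlib

open scoped ENNReal ContDiff MeasureTheory

namespace TangentialBernstein

/-- `M` is a `C^∞` embedded submanifold (without boundary) of dimension `n` of `ℝ^m`: around each
of its points there is a smooth diffeomorphism `φ` between open subsets of `ℝ^m` which maps `M`
onto a piece of an `n`-dimensional linear subspace `W`. -/
def IsSmoothSubmanifold {m : ℕ} (n : ℕ) (M : Set (EuclideanSpace ℝ (Fin m))) : Prop :=
  ∀ x ∈ M, ∃ φ : OpenPartialHomeomorph (EuclideanSpace ℝ (Fin m)) (EuclideanSpace ℝ (Fin m)),
    x ∈ φ.source ∧ ContDiffOn ℝ ∞ φ φ.source ∧ ContDiffOn ℝ ∞ φ.symm φ.target ∧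
    ∃ W : Submodule ℝ (EuclideanSpace ℝ (Fin m)), Module.finrank ℝ W = n ∧
      ∀ y ∈ φ.source, y ∈ M ↔ φ y ∈ W

/-- The tangent space of `M` at `x`, as a linear subspace of `ℝ^m`: the span of the velocities at
time `0` of the curves in `M` that pass through `x` at time `0`. -/
def tangentSpaceAt {m : ℕ} (M : Set (EuclideanSpace ℝ (Fin m))) (x : EuclideanSpace ℝ (Fin m)) :
    Submodule ℝ (EuclideanSpace ℝ (Fin m)) :=
  Submodule.span ℝ {v | ∃ γ : ℝ → EuclideanSpace ℝ (Fin m),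
    γ 0 = x ∧ (∀ᶠ t in nhds (0 : ℝ), γ t ∈ M) ∧ HasDerivAt γ v 0}

/-- The function on `ℝ^m` given by a real polynomial in `m` variables. -/
noncomputable def polyFun {m : ℕ} (p : MvPolynomial (Fin m) ℝ) (x : EuclideanSpace ℝ (Fin m)) : ℝ :=
  MvPolynomial.eval (fun i => x i) p

/-- The tangential gradient `∇_t p (x)`: the orthogonal projection of the gradient of `p` at `x`
onto the tangent space of `M` at `x`. -/
noncomputable def tangentialGradient {m : ℕ} (M : Set (EuclideanSpace ℝ (Fin m)))
    (p : MvPolynomial (Fin m) ℝ) (x : EuclideanSpace ℝ (Fin m)) : EuclideanSpace ℝ (Fin m) :=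
  (tangentSpaceAt M x).starProjection (gradient (polyFun p) x)

/-- The volume measure of an `n`-dimensional submanifold `M` of `ℝ^m`: the `n`-dimensional Hausdorff
measure, normalized to agree with Lebesgue measure on `ℝ^n`, restricted to `M`. -/
noncomputable def volumeMeasure {m : ℕ} (n : ℕ) (M : Set (EuclideanSpace ℝ (Fin m))) :
    MeasureTheory.Measure (EuclideanSpace ℝ (Fin m)) :=
  (μHE[n]).restrict M

/-- The `L^q` tangential Bernstein inequality with constant `C`:
`‖∇_t p‖_{L^q(M)} ≤ C deg(p) ‖p‖_{L^q(M)}` for all real polynomials `p`. -/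
def BernsteinInequality {m : ℕ} (n : ℕ) (M : Set (EuclideanSpace ℝ (Fin m))) (q : ℝ≥0∞)
    (C : ℝ) : Prop :=
  ∀ p : MvPolynomial (Fin m) ℝ,
    MeasureTheory.eLpNorm (tangentialGradient M p) q (volumeMeasure n M) ≤
      ENNReal.ofReal (C * p.totalDegree) * MeasureTheory.eLpNorm (polyFun p) q (volumeMeasure n M)

/-- The Zariski closure of `M` in `ℝ^m`: the common zero set of all real polynomials that vanish
on `M`, i.e. the smallest real algebraic subset of `ℝ^m` that contains `M`. -/
def zariskiClosure {m : ℕ} (M : Set (EuclideanSpace ℝ (Fin m))) : Set (EuclideanSpace ℝ (Fin m)) :=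
  {x | ∀ p : MvPolynomial (Fin m) ℝ, (∀ y ∈ M, polyFun p y = 0) → polyFun p x = 0}

/-- The dimension of a real algebraic subset `V` of `ℝ^m`: the Krull dimension of its ring of
polynomial functions `ℝ[x_1, …, x_m] / I(V)`. -/
noncomputable def algebraicDim {m : ℕ} (V : Set (EuclideanSpace ℝ (Fin m))) : WithBot ℕ∞ :=
  ringKrullDim
    (MvPolynomial (Fin m) ℝ ⧸ MvPolynomial.vanishingIdeal ℝ ((WithLp.ofLp (p := 2)) '' V))

/-- A submanifold `M` of `ℝ^m` of dimension `n` is algebraic if its Zariski closure is a real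
algebraic set of the same dimension `n`. -/
def IsAlgebraicSubmanifold {m : ℕ} (n : ℕ) (M : Set (EuclideanSpace ℝ (Fin m))) : Prop :=
  algebraicDim (zariskiClosure M) = n

end TangentialBernstein

namespace TangentialBernstein

/-! ### Krull dimension of finitely generated algebras -/

/-! Upper bound: count dimensions. Cover `M` by finitely many cubical charts and cut each cube into
`N ^ n` cells. If all cell integrals of `p` vanish, the Poincaré inequality on each cell gives `‖p‖
≤ (K / N) ‖∇_t p‖`, with `K` independent of `N` (`eLpNorm_polyFun_le_of_gridIntegrals_eq_zero`). For
`deg p ≤ k` the Bernstein inequality turns this into `‖p‖ ≤ (K C k / N) ‖p‖`. With `N = A k` and `A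
> 2 K C` the factor is below `1 / 2`, so `p = 0` on `M`. Polynomials of degree at most `k`,
restricted to `M`, are thus determined by `O(k ^ n)` cell integrals. By Noether normalization an
algebra of dimension `s` has a Hilbert function of order at least `k ^ s`, so `s ≤ n`
(`ringKrullDim_quotient_le_of_finrank_le`).

Lower bound: some linear map sends a chart of `M` onto a set with interior in `ℝ^n`, so its `n`
coordinate forms are algebraically independent modulo the ideal of `M`
(`le_ringKrullDim_of_isCubeChart`). This half does not need the Bernstein inequality. -/

theorem ringKrullDim_eq_of_isIntegral {R S : Type*} [CommRing R] [CommRing S] [Algebra R S]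
    [Algebra.IsIntegral R S] (hinj : Function.Injective (algebraMap R S)) :
    ringKrullDim S = ringKrullDim R := by
  refine le_antisymm ?_ ?_
  -- Incomparability: contraction of primes is strictly monotone.
  · exact Order.krullDim_le_of_strictMono (PrimeSpectrum.comap (algebraMap R S))
      fun I J h => Ideal.IsIntegral.comap_lt_comap h
  -- Lying over lifts the bottom of a chain of primes of `R`; going up lifts the rest.
  · refine iSup_le fun l => ?_
    obtain ⟨P, -, hP, hPl⟩ := Ideal.exists_ideal_over_prime_of_isIntegral (S := S)
      (RelSeries.head l).asIdeal ⊥ (by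
        rw [← RingHom.ker_eq_comap_bot, (RingHom.injective_iff_ker_eq_bot _).1 hinj]; exact bot_le)
    have : P.LiesOver (RelSeries.head l).asIdeal := ⟨hPl.symm⟩
    obtain ⟨L, hL, -⟩ := Ideal.exists_ltSeries_of_hasGoingUp l P
    rw [← hL]
    exact Order.LTSeries.length_le_krullDim L

theorem ringKrullDim_eq_of_isIntegral_mvPolynomial {k R : Type*} [Field k] [CommRing R]
    [Algebra k R] {s : ℕ} (g : MvPolynomial (Fin s) k →ₐ[k] R) (hg : Function.Injective g)
    (hint : g.IsIntegral) : ringKrullDim R = s := by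
  let _ : Algebra (MvPolynomial (Fin s) k) R := g.toRingHom.toAlgebra
  have : Algebra.IsIntegral (MvPolynomial (Fin s) k) R := ⟨hint⟩
  rw [ringKrullDim_eq_of_isIntegral (R := MvPolynomial (Fin s) k) hg,
    MvPolynomial.ringKrullDim_of_isNoetherianRing, ringKrullDim_eq_zero_of_field]
  simp

/-- By Noether normalization `D` is integral over a polynomial ring in `s = dim D` variables, so its
transcendence degree is at most `s`, while `f` exhibits `n` algebraically independent elements. -/
theorem le_ringKrullDim_of_injective_of_isDomain {k D : Type*} [Field k] [CommRing D] [IsDomain D]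
    [Algebra k D] [Algebra.FiniteType k D] {n : ℕ} (f : MvPolynomial (Fin n) k →ₐ[k] D)
    (hf : Function.Injective f) : (n : WithBot ℕ∞) ≤ ringKrullDim D := by
  obtain ⟨s, g, hg, hint⟩ := exists_integral_inj_algHom_of_fg k D
  rw [ringKrullDim_eq_of_isIntegral_mvPolynomial g hg hint]
  have h1 : (n : Cardinal) ≤ Algebra.trdeg k D := by
    have := lift_trdeg_le_of_injective f hf
    rw [MvPolynomial.trdeg_of_isDomain] at this
    simpa using this
  have h2 : Algebra.trdeg k D ≤ s := by
    have hr : g.range = Algebra.adjoin k (Set.range fun i => g (MvPolynomial.X i)) := by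
      rw [← Algebra.map_top, ← MvPolynomial.adjoin_range_X, AlgHom.map_adjoin, ← Set.range_comp]
      rfl
    have : Algebra.IsAlgebraic (Algebra.adjoin k (Set.range fun i => g (MvPolynomial.X i))) D := by
      rw [← hr]
      have : Algebra.IsIntegral g.range D := by
        refine ⟨fun x => ?_⟩
        obtain ⟨p, hp, hx⟩ := hint x
        refine ⟨p.map g.rangeRestrict.toRingHom, hp.map _, ?_⟩
        rw [Polynomial.eval₂_map]
        exact hx
      infer_instance
    refine (Algebra.IsAlgebraic.trdeg_le_cardinalMk k
      (Set.range fun i => g (MvPolynomial.X i))).trans ?_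
    have := Cardinal.mk_range_le_lift (f := fun i => g (MvPolynomial.X i))
    simpa using this
  exact_mod_cast h1.trans h2

/-- Reduction to a domain, since the ideal of `M` need not be prime: the minimal prime `⊥` of the
polynomial ring is contracted from a prime `P` of `R`, so the ring still injects into `R ⧸ P`. -/
theorem le_ringKrullDim_of_injective {k R : Type*} [Field k] [CommRing R]
    [Algebra k R] [Algebra.FiniteType k R] {n : ℕ} (f : MvPolynomial (Fin n) k →ₐ[k] R)
    (hf : Function.Injective f) : (n : WithBot ℕ∞) ≤ ringKrullDim R := by
  obtain ⟨P, hP, hPf⟩ := Ideal.exists_comap_eq_of_mem_minimalPrimes_of_injective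
    (f := f.toRingHom) hf ⊥ (by rw [IsDomain.minimalPrimes_eq_singleton_bot]; rfl)
  have hi : Function.Injective ((Ideal.Quotient.mkₐ k P).comp f) := by
    refine (injective_iff_map_eq_zero _).2 fun x hx => ?_
    have : x ∈ Ideal.comap f.toRingHom P :=
      Ideal.mem_comap.2 (Ideal.Quotient.eq_zero_iff_mem.1 hx)
    rwa [hPf] at this
  exact (le_ringKrullDim_of_injective_of_isDomain _ hi).trans (ringKrullDim_quotient_le P)

theorem totalDegree_aeval_le {k σ τ : Type*} [Field k] [Fintype σ] (f : σ → MvPolynomial τ k)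
    {D N : ℕ} (hf : ∀ i, (f i).totalDegree ≤ D) (p : MvPolynomial σ k)
    (hp : p ∈ MvPolynomial.restrictDegree σ k N) :
    (MvPolynomial.aeval f p).totalDegree ≤ Fintype.card σ * N * D := by
  rw [MvPolynomial.mem_restrictDegree] at hp
  rw [MvPolynomial.aeval_def, MvPolynomial.eval₂_eq']
  refine MvPolynomial.totalDegree_finsetSum_le fun d hd => ?_
  refine (MvPolynomial.totalDegree_mul _ _).trans ?_
  rw [MvPolynomial.algebraMap_eq, MvPolynomial.totalDegree_C, zero_add]
  refine (MvPolynomial.totalDegree_finsetProd _ _).trans ?_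
  calc _ ≤ ∑ _i : σ, N * D := Finset.sum_le_sum fun i _ =>
        (MvPolynomial.totalDegree_pow _ _).trans (Nat.mul_le_mul (hp d hd i) (hf i))
    _ = _ := by simp [mul_assoc]

theorem finrank_restrictDegree (k : Type*) [Field k] (s N : ℕ) :
    Module.finrank k (MvPolynomial.restrictDegree (Fin s) k N) = (N + 1) ^ s := by
  rw [MvPolynomial.restrictDegree,
    Module.finrank_eq_nat_card_basis (MvPolynomial.basisRestrictSupport k _)]
  have e : {n : Fin s →₀ ℕ | ∀ i, n i ≤ N} ≃ (Fin s → Fin (N + 1)) :=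
    { toFun := fun n i => ⟨n.1 i, Nat.lt_succ_of_le (n.2 i)⟩
      invFun := fun v => ⟨Finsupp.equivFunOnFinite.symm fun i => (v i : ℕ),
        fun i => Nat.le_of_lt_succ (v i).2⟩
      left_inv := fun n => by ext; simp
      right_inv := fun v => by ext; simp }
  rw [Nat.card_congr e]
  simp

/-- If the Hilbert function of an affine algebra grows at most like `N ^ n`, then its Krull
dimension is at most `n`. -/
theorem ringKrullDim_quotient_le_of_finrank_le {k : Type*} [Field k] {m n A : ℕ}
    (I : Ideal (MvPolynomial (Fin m) k))
    (h : ∀ N : ℕ, 1 ≤ N → Module.finrank k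
      ((MvPolynomial.restrictTotalDegree (Fin m) k N).map (Ideal.Quotient.mkₐ k I).toLinearMap)
        ≤ A * N ^ n) :
    ringKrullDim (MvPolynomial (Fin m) k ⧸ I) ≤ n := by
  cases subsingleton_or_nontrivial (MvPolynomial (Fin m) k ⧸ I) with
  | inl _ => rw [ringKrullDim_eq_bot_of_subsingleton]; exact bot_le
  | inr _ =>
  obtain ⟨s, g, hg, hint⟩ := exists_integral_inj_algHom_of_fg k (MvPolynomial (Fin m) k ⧸ I)
  rw [ringKrullDim_eq_of_isIntegral_mvPolynomial g hg hint]
  by_contra hlt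
  have hns : n + 1 ≤ s := by
    have : ¬ s ≤ n := fun h => hlt (by exact_mod_cast h)
    omega
  choose f hf using fun i : Fin s => Ideal.Quotient.mk_surjective (g (MvPolynomial.X i))
  set D := Finset.univ.sup fun i => (f i).totalDegree
  have hD : ∀ i, (f i).totalDegree ≤ D := fun i =>
    Finset.le_sup (f := fun i => (f i).totalDegree) (Finset.mem_univ i)
  have hga : g = (Ideal.Quotient.mkₐ k I).comp (MvPolynomial.aeval f) := by
    ext i; simp [hf]
  -- The injection `g` embeds the `(N + 1) ^ s`-dimensional space of polynomials of degree at most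
  -- `N` in each variable; the images lift to total degree at most `s * N * D`. The `+ 1` keeps the
  -- degree bound positive when `s * D = 0`.
  have key : ∀ N : ℕ, 1 ≤ N → (N + 1) ^ s ≤ A * ((s * D + 1) * N) ^ n := by
    intro N hN
    refine le_trans ?_ (h ((s * D + 1) * N) (Nat.mul_pos (Nat.succ_pos _) hN))
    rw [← finrank_restrictDegree k s N,
      (Submodule.equivMapOfInjective g.toLinearMap hg _).finrank_eq]
    refine Submodule.finrank_mono ?_
    rintro _ ⟨p, hp, rfl⟩
    refine ⟨MvPolynomial.aeval f p, ?_, by rw [hga]; rfl⟩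
    rw [SetLike.mem_coe, MvPolynomial.mem_restrictTotalDegree]
    refine (totalDegree_aeval_le f hD p hp).trans ?_
    rw [Fintype.card_fin]
    nlinarith
  -- Taking `N = B + 1` makes `key` read `(B + 2) ^ s ≤ B * (B + 1) ^ n`, impossible for `s ≥ n +
  -- 1`.
  have h1 := key (A * (s * D + 1) ^ n + 1) (by omega)
  set B := A * (s * D + 1) ^ n with hB
  have h2 : (B + 1) ^ (n + 1) ≤ (B + 1 + 1) ^ s :=
    (Nat.pow_le_pow_left (by omega) _).trans (Nat.pow_le_pow_right (by omega) hns)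
  rw [mul_pow, ← mul_assoc, ← hB] at h1
  have h3 : (B + 1) * (B + 1) ^ n ≤ B * (B + 1) ^ n := by
    rw [← pow_succ']; exact h2.trans h1
  have := Nat.le_of_mul_le_mul_right h3 (by positivity)
  omega

/-! ### The Poincaré inequality on convex sets -/

section Poincare

open MeasureTheory

theorem enorm_sub_le_lintegral_fderiv {E : Type*} [NormedAddCommGroup E] [NormedSpace ℝ E]
    {f : E → ℝ} {U c : Set E} (hU : IsOpen U)
    (hf : ContDiffOn ℝ 1 f U) (hcU : c ⊆ U) (hc : Convex ℝ c) {x y : E} (hx : x ∈ c) (hy : y ∈ c) :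
    ‖f y - f x‖ₑ ≤ ‖y - x‖ₑ * ∫⁻ t in Set.Icc (0 : ℝ) 1,
      ‖fderiv ℝ f ((1 - t) • x + t • y)‖ₑ := by
  have hmem : ∀ t ∈ Set.Icc (0 : ℝ) 1, (1 - t) • x + t • y ∈ c := fun t ht =>
    hc hx hy (by linarith [ht.2]) ht.1 (by ring)
  set γ : ℝ → E := fun t => (1 - t) • x + t • y with hγ
  have hγd : ContDiff ℝ 1 γ := by fun_prop
  have hcd : ContDiffOn ℝ 1 (f ∘ γ) (Set.Icc 0 1) :=
    hf.comp hγd.contDiffOn fun t ht => hcU (hmem t ht)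
  have h1 := enorm_sub_le_lintegral_deriv_of_contDiffOn_Icc hcd zero_le_one
  have hγ' : ∀ t, HasDerivAt γ (y - x) t := by
    intro t
    have := (((hasDerivAt_id t).const_sub 1).smul_const x).add ((hasDerivAt_id t).smul_const y)
    convert! this using 1
    simp [sub_eq_neg_add]
  have e0 : (f ∘ γ) 1 - (f ∘ γ) 0 = f y - f x := by simp [hγ]
  rw [e0] at h1
  refine h1.trans ?_
  rw [← lintegral_const_mul' _ _ (by simp)]
  refine setLIntegral_mono' measurableSet_Icc fun t ht => ?_
  have hd : HasFDerivAt f (fderiv ℝ f (γ t)) (γ t) :=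
    ((hf.contDiffAt (hU.mem_nhds (hcU (hmem t ht)))).differentiableAt one_ne_zero).hasFDerivAt
  rw [(hd.comp_hasDerivAt t (hγ' t)).deriv, mul_comm]
  exact ContinuousLinearMap.le_opENorm _ _

variable {E : Type*} [NormedAddCommGroup E] [NormedSpace ℝ E] [FiniteDimensional ℝ E]
  [MeasurableSpace E] [BorelSpace E]

/-- The substitution `z = a • x + b • y` stays in `c` by convexity and has Jacobian factor `a⁻¹ ^ d
≤ 2 ^ d`, where `d` is the dimension of `E`. -/
theorem setLIntegral_comp_smul_add_smul_le (μ : Measure E) [μ.IsAddHaarMeasure] {c : Set E}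
    (hc : Convex ℝ c) (hcm : MeasurableSet c) {h : E → ℝ≥0∞} (hh : Measurable h) {a b : ℝ}
    (ha : 1 / 2 ≤ a) (hb : 0 ≤ b) (hab : a + b = 1) {y : E} (hy : y ∈ c) :
    ∫⁻ x in c, h (a • x + b • y) ∂μ ≤ 2 ^ Module.finrank ℝ E * ∫⁻ x in c, h x ∂μ := by
  have ha0 : 0 < a := by linarith
  have hF : Measurable (c.indicator h) := hh.indicator hcm
  calc ∫⁻ x in c, h (a • x + b • y) ∂μ
      = ∫⁻ x in c, c.indicator h (a • x + b • y) ∂μ :=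
        setLIntegral_congr_fun hcm fun x hx => by
          simp only [Set.indicator_of_mem (hc hx hy ha0.le hb hab)]
    _ ≤ ∫⁻ x, c.indicator h (a • x + b • y) ∂μ := setLIntegral_le_lintegral _ _
    _ = ∫⁻ z, c.indicator h (z + b • y) ∂(μ.map (a • ·)) := by
        rw [lintegral_map (f := fun z => c.indicator h (z + b • y))
          (hF.comp (measurable_add_const _)) (measurable_const_smul a)]
    _ = ENNReal.ofReal |(a ^ Module.finrank ℝ E)⁻¹| * ∫⁻ x in c, h x ∂μ := by
        rw [Measure.map_addHaar_smul μ ha0.ne', lintegral_smul_measure,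
          lintegral_add_right_eq_self, lintegral_indicator hcm, smul_eq_mul]
    _ ≤ _ := by
        gcongr
        rw [abs_of_pos (by positivity), ← inv_pow, ENNReal.ofReal_pow (by positivity)]
        gcongr
        rw [ENNReal.ofReal_le_iff_le_toReal (by simp)]
        rw [inv_le_comm₀ ha0 (by simp)]
        simpa using ha

theorem lintegral_cond_comp_segment_le (μ : Measure E) [μ.IsAddHaarMeasure] {c : Set E}
    (hc : Convex ℝ c) (hcm : MeasurableSet c) (hc0 : μ c ≠ 0) (hct : μ c ≠ ⊤)
    {h : E → ℝ≥0∞} (hh : Measurable h)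
    {t : ℝ} (ht : t ∈ Set.Icc (0 : ℝ) 1) :
    ∫⁻ x, ∫⁻ y, h ((1 - t) • x + t • y) ∂(ProbabilityTheory.cond μ c) ∂(ProbabilityTheory.cond μ c)
      ≤ 2 ^ Module.finrank ℝ E * ∫⁻ x, h x ∂(ProbabilityTheory.cond μ c) := by
  have : IsProbabilityMeasure (ProbabilityTheory.cond μ c) :=
    ProbabilityTheory.cond_isProbabilityMeasure_of_finite hc0 hct
  have key : ∀ {a b : ℝ}, 1 / 2 ≤ a → 0 ≤ b → a + b = 1 →
      ∫⁻ y, ∫⁻ x, h (a • x + b • y) ∂(ProbabilityTheory.cond μ c) ∂(ProbabilityTheory.cond μ c)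
      ≤ 2 ^ Module.finrank ℝ E * ∫⁻ x, h x ∂(ProbabilityTheory.cond μ c) := by
    intro a b ha hb hab
    refine (lintegral_mono_ae (g := fun _ => 2 ^ Module.finrank ℝ E *
      ∫⁻ x, h x ∂(ProbabilityTheory.cond μ c)) ?_).trans (by simp)
    have hmem : ∀ᵐ y ∂(ProbabilityTheory.cond μ c), y ∈ c :=
      Measure.ae_smul_measure (ae_restrict_mem hcm) _
    filter_upwards [hmem] with y hy
    simp only [ProbabilityTheory.cond, lintegral_smul_measure, smul_eq_mul]
    rw [mul_left_comm]
    gcongr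
    exact setLIntegral_comp_smul_add_smul_le μ hc hcm hh ha hb hab hy
  -- Integrate first in the endpoint with the larger coefficient, so that the dilation factor is at
  -- least `1 / 2`.
  rcases le_total t (1 / 2) with h2 | h2
  · rw [lintegral_lintegral_swap (by fun_prop)]
    exact key (by linarith) ht.1 (by ring)
  · have := key (a := t) (b := 1 - t) h2 (by linarith [ht.2]) (by ring)
    simpa only [add_comm] using this

/-- A uniform point on the segment between two independent uniform points of `c` has law at most `2
^ d` times the uniform law. As a domination of measures this serves every `q`, including `∞`. -/
theorem map_segment_le (μ : Measure E) [μ.IsAddHaarMeasure] {c : Set E}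
    (hc : Convex ℝ c) (hcm : MeasurableSet c) (hc0 : μ c ≠ 0) (hct : μ c ≠ ⊤) :
    ((ProbabilityTheory.cond μ c).prod ((ProbabilityTheory.cond μ c).prod
      (volume.restrict (Set.Icc (0 : ℝ) 1)))).map
        (fun w : E × E × ℝ => (1 - w.2.2) • w.1 + w.2.2 • w.2.1) ≤
      (2 ^ Module.finrank ℝ E : ℝ≥0∞) • ProbabilityTheory.cond μ c := by
  have : IsProbabilityMeasure (ProbabilityTheory.cond μ c) :=
    ProbabilityTheory.cond_isProbabilityMeasure_of_finite hc0 hct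
  have hk : Measurable fun w : E × E × ℝ => (1 - w.2.2) • w.1 + w.2.2 • w.2.1 := by fun_prop
  refine Measure.le_iff.2 fun s hs => ?_
  set h : E → ℝ≥0∞ := s.indicator 1 with hdef
  have hh : Measurable h := measurable_one.indicator hs
  rw [← lintegral_indicator_one hs, lintegral_map hh hk, lintegral_prod _ (by fun_prop)]
  have e1 : ∀ x, ∫⁻ w, h ((1 - w.2) • x + w.2 • w.1) ∂((ProbabilityTheory.cond μ c).prod
      (volume.restrict (Set.Icc (0 : ℝ) 1))) =
      ∫⁻ t in Set.Icc (0 : ℝ) 1, ∫⁻ y, h ((1 - t) • x + t • y) ∂(ProbabilityTheory.cond μ c) :=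
    fun x => lintegral_prod_symm _ (by fun_prop)
  simp_rw [e1]
  rw [lintegral_lintegral_swap (by
    refine Measurable.aemeasurable ?_
    refine Measurable.lintegral_prod_right' (f := fun w : (E × ℝ) × E =>
      h ((1 - w.1.2) • w.1.1 + w.1.2 • w.2)) ?_
    fun_prop)]
  calc _ ≤ ∫⁻ _t in Set.Icc (0 : ℝ) 1, (2 ^ Module.finrank ℝ E : ℝ≥0∞) *
        ∫⁻ x, h x ∂(ProbabilityTheory.cond μ c) :=
        setLIntegral_mono' measurableSet_Icc fun t ht =>
          lintegral_cond_comp_segment_le μ hc hcm hc0 hct hh ht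
    _ = _ := by
      rw [lintegral_const, hdef, lintegral_indicator_one hs]
      simp

/-- Jensen's inequality in each fibre: on a probability space the `L^1` norm is at most the `L^q`
norm. -/
theorem eLpNorm_lintegral_le_eLpNorm_prod {α β : Type*} [MeasurableSpace α] [MeasurableSpace β]
    {μ : Measure α} [SFinite μ] {P : Measure β} [IsProbabilityMeasure P] {q : ℝ≥0∞} (hq : 1 ≤ q)
    {g : α × β → ℝ≥0∞} (hg : Measurable g) :
    eLpNorm (fun x => ∫⁻ w, g (x, w) ∂P) q μ ≤ eLpNorm g q (μ.prod P) := by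
  have hq0 : q ≠ 0 := (zero_lt_one.trans_le hq).ne'
  by_cases hqt : q = ⊤
  · subst hqt
    rw [eLpNorm_exponent_top, eLpNorm_exponent_top]
    refine essSup_le_of_ae_le _ ?_
    filter_upwards [Measure.ae_ae_of_ae_prod (ae_le_eLpNormEssSup (f := g) (μ := μ.prod P))]
      with x hx
    refine (lintegral_mono_ae hx).trans ?_
    simp
  · have hqr : 0 < q.toReal := ENNReal.toReal_pos hq0 hqt
    rw [eLpNorm_eq_lintegral_rpow_enorm_toReal hq0 hqt,
      eLpNorm_eq_lintegral_rpow_enorm_toReal hq0 hqt]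
    refine ENNReal.rpow_le_rpow ?_ (by positivity)
    rw [lintegral_prod _ (by fun_prop)]
    refine lintegral_mono fun x => ?_
    have hgx : Measurable fun w => g (x, w) := by fun_prop
    have := eLpNorm_le_eLpNorm_of_exponent_le (μ := P) hq hgx.aestronglyMeasurable
    rw [eLpNorm_one_eq_lintegral_enorm, eLpNorm_eq_lintegral_rpow_enorm_toReal hq0 hqt] at this
    have h2 := ENNReal.rpow_le_rpow this hqr.le
    rw [← ENNReal.rpow_mul, one_div, inv_mul_cancel₀ hqr.ne', ENNReal.rpow_one] at h2
    exact h2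

theorem eLpNorm_cond_le_of_integral_eq_zero (μ : Measure E) [μ.IsAddHaarMeasure] {U c : Set E}
    (hU : IsOpen U) (hcU : c ⊆ U) (hc : Convex ℝ c) (hcm : MeasurableSet c)
    (hc0 : μ c ≠ 0) (hct : μ c ≠ ⊤) {δ : ℝ≥0∞} (hδ : ∀ x ∈ c, ∀ y ∈ c, edist x y ≤ δ)
    {f : E → ℝ} (hf : ContDiffOn ℝ 1 f U) (hfi : IntegrableOn f c μ)
    (hf0 : ∫ x in c, f x ∂μ = 0) {q : ℝ≥0∞} (hq : 1 ≤ q) :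
    eLpNorm f q (ProbabilityTheory.cond μ c) ≤
      2 ^ Module.finrank ℝ E * δ * eLpNorm (fderiv ℝ f) q (ProbabilityTheory.cond μ c) := by
  set ν := ProbabilityTheory.cond μ c with hν
  have : IsProbabilityMeasure ν :=
    ProbabilityTheory.cond_isProbabilityMeasure_of_finite hc0 hct
  set I : Measure ℝ := volume.restrict (Set.Icc (0 : ℝ) 1)
  have : IsProbabilityMeasure I := ⟨by simp [I]⟩
  have hq0 : q ≠ 0 := (zero_lt_one.trans_le hq).ne'
  have hmem : ∀ᵐ y ∂ν, y ∈ c := Measure.ae_smul_measure (ae_restrict_mem hcm) _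
  set g : E → ℝ≥0∞ := fun x => ‖fderiv ℝ f x‖ₑ
  have hg : Measurable g := (measurable_fderiv ℝ f).enorm
  set k : E × E × ℝ → E := fun w => (1 - w.2.2) • w.1 + w.2.2 • w.2.1
  have hk : Measurable k := by fun_prop
  have hfν : Integrable f ν := hfi.smul_measure (by simpa using hc0)
  have hfν0 : ∫ x, f x ∂ν = 0 := by
    rw [hν, ProbabilityTheory.cond, integral_smul_measure, hf0, smul_zero]
  have hpt : ∀ᵐ x ∂ν, ‖f x‖ₑ ≤ δ * ‖∫⁻ w, g (k (x, w)) ∂(ν.prod I)‖ₑ := by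
    filter_upwards [hmem] with x hx
    -- The zero mean turns a value of `f` into an average of differences, each controlled by the
    -- derivative along a segment.
    have e : f x = ∫ y, (f x - f y) ∂ν := by
      rw [integral_sub (integrable_const _) hfν, hfν0]; simp
    rw [e, enorm_eq_self, lintegral_prod _ (by fun_prop), ← lintegral_const_mul _
      (by
        refine Measurable.lintegral_prod_right' (f := fun w : E × ℝ => g (k (x, w))) ?_
        fun_prop)]
    refine (enorm_integral_le_lintegral_enorm _).trans (lintegral_mono_ae ?_)
    filter_upwards [hmem] with y hy
    rw [← enorm_neg, neg_sub]
    refine (enorm_sub_le_lintegral_fderiv hU hf hcU hc hx hy).trans ?_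
    gcongr
    rw [← edist_eq_enorm_sub]
    exact hδ y hy x hx
  have hG : Measurable fun x => ∫⁻ w, g (k (x, w)) ∂(ν.prod I) := by
    refine Measurable.lintegral_prod_right' (f := fun w : E × (E × ℝ) => g (k w)) ?_
    fun_prop
  calc eLpNorm f q ν ≤ δ * eLpNorm (fun x => ∫⁻ w, g (k (x, w)) ∂(ν.prod I)) q ν :=
        eLpNorm_le_mul_eLpNorm_of_ae_le_mul'' q hG.aestronglyMeasurable hpt
    _ ≤ δ * eLpNorm (g ∘ k) q (ν.prod (ν.prod I)) := by
        gcongr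
        exact eLpNorm_lintegral_le_eLpNorm_prod (g := g ∘ k) hq (hg.comp hk)
    _ = δ * eLpNorm g q ((ν.prod (ν.prod I)).map k) := by
        rw [eLpNorm_map_measure hg.aestronglyMeasurable hk.aemeasurable]
    _ ≤ δ * eLpNorm g q ((2 ^ Module.finrank ℝ E : ℝ≥0∞) • ν) := by
        gcongr
        exact map_segment_le μ hc hcm hc0 hct
    _ = δ * ((2 ^ Module.finrank ℝ E : ℝ≥0∞) ^ (1 / q).toReal * eLpNorm (fderiv ℝ f) q ν) := by
        rw [eLpNorm_smul_measure_of_ne_zero (by simp), smul_eq_mul]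
        simp only [g, eLpNorm_enorm]
    _ ≤ _ := by
        rw [mul_comm (_ ^ _) δ, mul_assoc]
        gcongr
        refine (ENNReal.rpow_le_rpow_of_exponent_le (z := 1) ?_ ?_).trans_eq (ENNReal.rpow_one _)
        · exact one_le_pow₀ (by norm_num)
        · refine ENNReal.toReal_le_of_le_ofReal zero_le_one ?_
          simpa using hq

/-- The `L^q` **Poincaré inequality** on a bounded convex set. -/
theorem eLpNorm_restrict_le_of_integral_eq_zero (μ : Measure E) [μ.IsAddHaarMeasure] {U c : Set E}
    (hU : IsOpen U) (hcU : c ⊆ U) (hc : Convex ℝ c) (hcm : MeasurableSet c)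
    (hct : μ c ≠ ⊤) {δ : ℝ≥0∞} (hδ : ∀ x ∈ c, ∀ y ∈ c, edist x y ≤ δ)
    {f : E → ℝ} (hf : ContDiffOn ℝ 1 f U) (hfi : IntegrableOn f c μ)
    (hf0 : ∫ x in c, f x ∂μ = 0) {q : ℝ≥0∞} (hq : 1 ≤ q) :
    eLpNorm f q (μ.restrict c) ≤
      2 ^ Module.finrank ℝ E * δ * eLpNorm (fderiv ℝ f) q (μ.restrict c) := by
  by_cases hc0 : μ c = 0
  · rw [Measure.restrict_eq_zero.2 hc0]; simp
  have e : μ.restrict c = μ c • ProbabilityTheory.cond μ c := by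
    rw [ProbabilityTheory.cond, smul_smul, ENNReal.mul_inv_cancel hc0 hct, one_smul]
  rw [e, eLpNorm_smul_measure_of_ne_zero hc0, eLpNorm_smul_measure_of_ne_zero hc0, smul_eq_mul,
    smul_eq_mul, mul_left_comm]
  gcongr
  exact eLpNorm_cond_le_of_integral_eq_zero μ hU hcU hc hcm hc0 hct hδ hf hfi hf0 hq

/-- For finite `q` the `q`-th powers add over disjoint pieces. The constant does not depend on the
number of pieces, which is essential because the grid is refined. -/
theorem eLpNorm_restrict_iUnion_le {α ι F G : Type*} [MeasurableSpace α] [Countable ι]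
    [NormedAddCommGroup F] [NormedAddCommGroup G] {μ : Measure α} {c : ι → Set α}
    (hcm : ∀ i, MeasurableSet (c i)) (hd : Pairwise (Function.onFun Disjoint c))
    {f : α → F} {g : α → G} {q K : ℝ≥0∞}
    (h : ∀ i, eLpNorm f q (μ.restrict (c i)) ≤ K * eLpNorm g q (μ.restrict (c i))) :
    eLpNorm f q (μ.restrict (⋃ i, c i)) ≤ K * eLpNorm g q (μ.restrict (⋃ i, c i)) := by
  by_cases hq0 : q = 0
  · simp [hq0]
  by_cases hqt : q = ⊤
  · subst hqt
    simp only [eLpNorm_exponent_top] at h ⊢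
    refine essSup_le_of_ae_le _ ?_
    rw [Filter.EventuallyLE, ae_restrict_iUnion_iff]
    intro i
    filter_upwards [ae_le_eLpNormEssSup (f := f) (μ := μ.restrict (c i))] with x hx
    refine hx.trans ((h i).trans ?_)
    exact mul_le_mul' le_rfl (eLpNormEssSup_mono_measure g
      (Measure.absolutelyContinuous_of_le (Measure.restrict_mono (Set.subset_iUnion c i) le_rfl)))
  · have hqr : 0 < q.toReal := ENNReal.toReal_pos hq0 hqt
    have key : ∀ i, ∫⁻ x in c i, ‖f x‖ₑ ^ q.toReal ∂μ ≤
        K ^ q.toReal * ∫⁻ x in c i, ‖g x‖ₑ ^ q.toReal ∂μ := by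
      intro i
      have := ENNReal.rpow_le_rpow (h i) hqr.le
      rw [eLpNorm_eq_lintegral_rpow_enorm_toReal hq0 hqt,
        eLpNorm_eq_lintegral_rpow_enorm_toReal hq0 hqt, ENNReal.mul_rpow_of_nonneg _ _ hqr.le,
        ← ENNReal.rpow_mul, ← ENNReal.rpow_mul, one_div, inv_mul_cancel₀ hqr.ne',
        ENNReal.rpow_one, ENNReal.rpow_one] at this
      exact this
    rw [eLpNorm_eq_lintegral_rpow_enorm_toReal hq0 hqt,
      eLpNorm_eq_lintegral_rpow_enorm_toReal hq0 hqt, lintegral_iUnion hcm hd,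
      lintegral_iUnion hcm hd]
    calc _ ≤ (K ^ q.toReal * ∑' i, ∫⁻ x in c i, ‖g x‖ₑ ^ q.toReal ∂μ) ^ (1 / q.toReal) := by
          gcongr
          rw [← ENNReal.tsum_mul_left]
          exact ENNReal.tsum_le_tsum key
      _ = _ := by
          rw [ENNReal.mul_rpow_of_nonneg _ _ (by positivity), ← ENNReal.rpow_mul, one_div,
            mul_inv_cancel₀ hqr.ne', ENNReal.rpow_one]

end Poincare

/-! ### The grid on the unit cube -/

section Grid

open MeasureTheory

/-- The half-open unit cube. -/
def unitCube (n : ℕ) : Set (Fin n → ℝ) := Set.univ.pi fun _ => Set.Ico 0 1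

/-- The cells of the grid that divides the half-open unit cube into `N ^ n` cubes. -/
def gridCell {n : ℕ} (N : ℕ) (j : Fin n → Fin N) : Set (Fin n → ℝ) :=
  Set.univ.pi fun i => Set.Ico ((j i : ℝ) / N) (((j i : ℝ) + 1) / N)

theorem measurableSet_unitCube (n : ℕ) : MeasurableSet (unitCube n) :=
  MeasurableSet.univ_pi fun _ => measurableSet_Ico

theorem unitCube_subset_Icc (n : ℕ) : unitCube n ⊆ Set.Icc 0 1 := fun _ hx =>
  ⟨fun i => (hx i trivial).1, fun i => (hx i trivial).2.le⟩

theorem measurableSet_gridCell {n N : ℕ} (j : Fin n → Fin N) : MeasurableSet (gridCell N j) :=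
  MeasurableSet.univ_pi fun _ => measurableSet_Ico

theorem convex_gridCell {n N : ℕ} (j : Fin n → Fin N) : Convex ℝ (gridCell N j) :=
  convex_pi fun _ _ => convex_Ico _ _

theorem edist_le_of_mem_gridCell {n N : ℕ} (j : Fin n → Fin N) {x y : Fin n → ℝ}
    (hx : x ∈ gridCell N j) (hy : y ∈ gridCell N j) : edist x y ≤ ENNReal.ofReal (1 / N) := by
  refine edist_pi_le_iff.2 fun i => ?_
  rw [edist_dist]
  refine ENNReal.ofReal_le_ofReal ?_
  refine (Real.dist_le_of_mem_Icc (Set.Ico_subset_Icc_self (hx i trivial))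
    (Set.Ico_subset_Icc_self (hy i trivial))).trans_eq ?_
  ring

theorem mem_gridCell_iff {n N : ℕ} (hN : 0 < N) (j : Fin n → Fin N) (x : Fin n → ℝ) :
    x ∈ gridCell N j ↔ ∀ i, ⌊x i * N⌋ = (j i : ℤ) := by
  have hN' : (0 : ℝ) < N := by exact_mod_cast hN
  simp only [gridCell, Set.mem_univ_pi, Set.mem_Ico, Int.floor_eq_iff, div_le_iff₀ hN',
    lt_div_iff₀ hN', Int.cast_natCast]

theorem pairwise_disjoint_gridCell {n N : ℕ} (hN : 0 < N) :
    Pairwise (Function.onFun Disjoint (gridCell N : (Fin n → Fin N) → Set (Fin n → ℝ))) := by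
  intro j j' hjj
  refine Set.disjoint_left.2 fun x hx hx' => hjj ?_
  rw [mem_gridCell_iff hN] at hx hx'
  ext i
  have := (hx i).symm.trans (hx' i)
  exact_mod_cast this

theorem iUnion_gridCell {n N : ℕ} (hN : 0 < N) :
    ⋃ j : Fin n → Fin N, gridCell N j = unitCube n := by
  have hN' : (0 : ℝ) < N := by exact_mod_cast hN
  ext x
  simp only [Set.mem_iUnion, mem_gridCell_iff hN]
  constructor
  · rintro ⟨j, hj⟩ i -
    have h1 := Int.floor_eq_iff.1 (hj i)
    have h2 : ((j i : ℤ) : ℝ) + 1 ≤ N := by exact_mod_cast (j i).2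
    have h3 : (0 : ℝ) ≤ ((j i : ℤ) : ℝ) := by positivity
    constructor <;> nlinarith
  · intro hx
    have h0 : ∀ i, 0 ≤ ⌊x i * N⌋ := fun i =>
      Int.floor_nonneg.2 (mul_nonneg (hx i trivial).1 hN'.le)
    have h1 : ∀ i, ⌊x i * N⌋ < N := fun i => by
      rw [Int.floor_lt]
      have := (hx i trivial).2
      push_cast
      nlinarith
    refine ⟨fun i => ⟨⌊x i * N⌋.toNat, by have := h0 i; have := h1 i; omega⟩, fun i => ?_⟩
    exact (Int.toNat_of_nonneg (h0 i)).symm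

/-- In the sup norm every cell has diameter at most `1 / N`; this is the gain over the trivial
bound. -/
theorem eLpNorm_unitCube_le_of_integral_gridCell_eq_zero {n N : ℕ} (hN : 0 < N)
    {U : Set (Fin n → ℝ)} (hU : IsOpen U) (hQU : Set.Icc 0 1 ⊆ U) {f : (Fin n → ℝ) → ℝ}
    (hf : ContDiffOn ℝ 1 f U) (hf0 : ∀ j : Fin n → Fin N, ∫ x in gridCell N j, f x = 0)
    {q : ℝ≥0∞} (hq : 1 ≤ q) :
    eLpNorm f q (volume.restrict (unitCube n)) ≤
      2 ^ n * ENNReal.ofReal (1 / N) * eLpNorm (fderiv ℝ f) q (volume.restrict (unitCube n)) := by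
  have hcell : ∀ j : Fin n → Fin N, gridCell N j ⊆ Set.Icc 0 1 := fun j =>
    ((Set.subset_iUnion _ j).trans (iUnion_gridCell hN).subset).trans (unitCube_subset_Icc n)
  rw [← iUnion_gridCell hN]
  refine eLpNorm_restrict_iUnion_le measurableSet_gridCell (pairwise_disjoint_gridCell hN)
    fun j => ?_
  have hct : volume (gridCell N j) ≠ ⊤ :=
    ((measure_mono (hcell j)).trans_lt isCompact_Icc.measure_lt_top).ne
  have hfi : IntegrableOn f (gridCell N j) :=
    ((hf.continuousOn.mono hQU).integrableOn_compact isCompact_Icc).mono_set (hcell j)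
  have := eLpNorm_restrict_le_of_integral_eq_zero volume hU ((hcell j).trans hQU)
    (convex_gridCell j) (measurableSet_gridCell j) hct
    (fun x hx y hy => edist_le_of_mem_gridCell j hx hy) hf hfi (hf0 j) hq
  simpa using this

end Grid

/-! ### Cubical charts of a submanifold -/

/-- A parametrization `ψ` of a piece of `M`, defined on a neighbourhood `U` of the closed unit
cube, with a Lipschitz inverse `θ`. -/
structure IsCubeChart {m n : ℕ} (M : Set (EuclideanSpace ℝ (Fin m))) (L : NNReal)
    (U : Set (Fin n → ℝ)) (ψ : (Fin n → ℝ) → EuclideanSpace ℝ (Fin m))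
    (θ : EuclideanSpace ℝ (Fin m) → (Fin n → ℝ)) : Prop where
  isOpen : IsOpen U
  Icc_subset : Set.Icc 0 1 ⊆ U
  contDiffOn : ContDiffOn ℝ 1 ψ U
  mapsTo : Set.MapsTo ψ U M
  lipschitz : LipschitzOnWith L ψ U
  lipschitz_inv : LipschitzOnWith L θ (ψ '' U)
  leftInvOn : Set.LeftInvOn θ ψ U
  differentiableAt_inv : ∀ u ∈ U, DifferentiableAt ℝ θ (ψ u)

/-- Invert the straightening diffeomorphism on the slice `W`, identified linearly with `ℝ^n`, and
rescale so that the cube fits into a small ball. The inverse `θ` is the diffeomorphism followed by a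
linear left inverse of `ι`. -/
theorem exists_isCubeChart {m n : ℕ} {M : Set (EuclideanSpace ℝ (Fin m))}
    (hM : IsSmoothSubmanifold n M) {x : EuclideanSpace ℝ (Fin m)} (hx : x ∈ M) :
    ∃ (L : NNReal) (U : Set (Fin n → ℝ)) (ψ : (Fin n → ℝ) → EuclideanSpace ℝ (Fin m))
      (θ : EuclideanSpace ℝ (Fin m) → (Fin n → ℝ)),
      IsCubeChart M L U ψ θ ∧ ψ '' unitCube n ∈ nhdsWithin x M := by
  obtain ⟨φ, hxs, hφ, hφs, W, hW, hMW⟩ := hM x hx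
  have e : (Fin n → ℝ) ≃ₗ[ℝ] W := LinearEquiv.ofFinrankEq _ _ (by simp [hW])
  set ι : (Fin n → ℝ) →L[ℝ] EuclideanSpace ℝ (Fin m) :=
    LinearMap.toContinuousLinearMap (W.subtype ∘ₗ e.toLinearMap) with hι
  have hιmem : ∀ w, ι w ∈ W := fun w => (e w).2
  have hιinj : Function.Injective (W.subtype ∘ₗ e.toLinearMap) :=
    Subtype.val_injective.comp e.injective
  obtain ⟨π', hπ'⟩ := LinearMap.exists_leftInverse_of_injective _ (LinearMap.ker_eq_bot.2 hιinj)
  set π : EuclideanSpace ℝ (Fin m) →L[ℝ] (Fin n → ℝ) := LinearMap.toContinuousLinearMap π' with hπ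
  have hπι : ∀ w, π (ι w) = w := fun w => LinearMap.congr_fun hπ' w
  have hιπ : ∀ v ∈ W, ι (π v) = v := by
    intro v hv
    have : ι (e.symm ⟨v, hv⟩) = v := by
      change ((e (e.symm ⟨v, hv⟩) : W) : EuclideanSpace ℝ (Fin m)) = v
      simp
    rw [← this, hπι]
  have hφxW : φ x ∈ W := (hMW x hxs).1 hx
  set ψ₀ : (Fin n → ℝ) → EuclideanSpace ℝ (Fin m) := fun w => φ.symm (φ x + ι w) with hψ₀
  set θ₀ : EuclideanSpace ℝ (Fin m) → (Fin n → ℝ) := fun y => π (φ y - φ x) with hθ₀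
  have hψ₀0 : ψ₀ 0 = x := by simp [hψ₀, φ.left_inv hxs]
  have hθ₀x : θ₀ x = 0 := by simp [hθ₀]
  have hφx : ContDiffAt ℝ 1 φ x :=
    (hφ.contDiffAt (φ.open_source.mem_nhds hxs)).of_le (by exact_mod_cast le_top)
  have hψ₀t : ∀ w, φ x + ι w ∈ φ.target → ContDiffAt ℝ 1 ψ₀ w := by
    intro w hw
    have h1 : ContDiffAt ℝ 1 φ.symm (φ x + ι w) :=
      (hφs.contDiffAt (φ.open_target.mem_nhds hw)).of_le (by exact_mod_cast le_top)
    exact h1.comp w (contDiffAt_const.add ι.contDiff.contDiffAt)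
  have h0t : φ x + ι 0 ∈ φ.target := by simpa using φ.map_source hxs
  have hθ₀d : ContDiffAt ℝ 1 θ₀ x :=
    π.contDiff.contDiffAt.comp x (hφx.sub contDiffAt_const)
  obtain ⟨K₁, t₁, ht₁, hL₁⟩ := (hψ₀t 0 h0t).exists_lipschitzOnWith
  obtain ⟨K₂, t₂, ht₂, hL₂⟩ := hθ₀d.exists_lipschitzOnWith
  have hV : ∀ᶠ w in nhds (0 : Fin n → ℝ), w ∈ t₁ ∧ φ x + ι w ∈ φ.target ∧ ψ₀ w ∈ t₂ := by
    refine Filter.Eventually.and ht₁ (Filter.Eventually.and ?_ ?_)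
    · have : ContinuousAt (fun w => φ x + ι w) 0 := by fun_prop
      exact this (φ.open_target.mem_nhds h0t)
    · have := (hψ₀t 0 h0t).continuousAt
      exact this (by rwa [hψ₀0])
  obtain ⟨R, hR, hRV⟩ := Metric.eventually_nhds_iff_ball.1 hV
  set r := R / 2 with hr
  have hr0 : 0 < r := by positivity
  -- `σ` maps the closed unit cube onto the closed sup-norm ball of radius `r`; since `r = R / 2`,
  -- this lies in the open ball of radius `R`.
  set σ : (Fin n → ℝ) → (Fin n → ℝ) := fun u => r • ((2 : ℝ) • u - 1) with hσ
  set τ : (Fin n → ℝ) → (Fin n → ℝ) := fun w => (2 : ℝ)⁻¹ • (r⁻¹ • w + 1) with hτ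
  have hτσ : ∀ u, τ (σ u) = u := by
    intro u; ext i; simp [hτ, hσ]; field_simp; ring
  have hστ : ∀ w, σ (τ w) = w := by
    intro u; ext i; simp [hτ, hσ]; field_simp
  have hσd : ContDiff ℝ 1 σ := by fun_prop
  have hσL : LipschitzWith (Real.toNNReal (r * 2)) σ := by
    refine LipschitzWith.of_dist_le_mul fun u v => ?_
    rw [Real.coe_toNNReal _ (by positivity), dist_eq_norm, dist_eq_norm]
    have : σ u - σ v = (r * 2) • (u - v) := by ext i; simp [hσ]; ring
    rw [this, norm_smul, Real.norm_of_nonneg (by positivity)]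
  have hτL : LipschitzWith (Real.toNNReal (2⁻¹ * r⁻¹)) τ := by
    refine LipschitzWith.of_dist_le_mul fun u v => ?_
    rw [Real.coe_toNNReal _ (by positivity), dist_eq_norm, dist_eq_norm]
    have : τ u - τ v = (2⁻¹ * r⁻¹) • (u - v) := by ext i; simp [hτ]; ring
    rw [this, norm_smul, Real.norm_of_nonneg (by positivity)]
  have hleft : ∀ w ∈ Metric.ball (0 : Fin n → ℝ) R, θ₀ (ψ₀ w) = w := by
    intro w hw
    simp only [hθ₀, hψ₀, φ.right_inv (hRV w hw).2.1, add_sub_cancel_left, hπι]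
  set L₁ := K₁ * Real.toNNReal (r * 2)
  set L₂ := Real.toNNReal (2⁻¹ * r⁻¹) * K₂
  refine ⟨max L₁ L₂, σ ⁻¹' Metric.ball 0 R, ψ₀ ∘ σ, τ ∘ θ₀, ⟨?_, ?_, ?_, ?_, ?_, ?_, ?_, ?_⟩, ?_⟩
  · exact Metric.isOpen_ball.preimage hσd.continuous
  · intro u hu
    rw [Set.mem_preimage, mem_ball_zero_iff]
    refine lt_of_le_of_lt ((pi_norm_le_iff_of_nonneg hr0.le).2 fun i => ?_)
      (by rw [hr]; linarith : r < R)
    have h0 := hu.1 i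
    have h1 := hu.2 i
    simp only [Pi.zero_apply, Pi.one_apply] at h0 h1
    simp only [hσ, Pi.smul_apply, Pi.sub_apply, Pi.one_apply, smul_eq_mul, norm_mul,
      Real.norm_eq_abs, abs_of_pos hr0]
    exact mul_le_of_le_one_right hr0.le (abs_le.2 ⟨by linarith, by linarith⟩)
  · intro u hu
    exact ((hψ₀t _ (hRV _ hu).2.1).comp u hσd.contDiffAt).contDiffWithinAt
  · intro u hu
    have ht := (hRV _ hu).2.1
    refine (hMW _ (φ.map_target ht)).2 ?_
    rw [φ.right_inv ht]
    exact W.add_mem hφxW (hιmem _)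
  · have : LipschitzOnWith L₁ (ψ₀ ∘ σ) (σ ⁻¹' Metric.ball 0 R) :=
      hL₁.comp hσL.lipschitzOnWith fun u hu => (hRV _ hu).1
    exact this.weaken (le_max_left _ _)
  · have : LipschitzOnWith L₂ (τ ∘ θ₀) (ψ₀ ∘ σ '' (σ ⁻¹' Metric.ball 0 R)) := by
      refine hτL.comp_lipschitzOnWith (hL₂.mono ?_)
      rintro _ ⟨u, hu, rfl⟩
      exact (hRV _ hu).2.2
    exact this.weaken (le_max_right _ _)
  · intro u hu
    simp only [Function.comp_apply]
    rw [hleft _ hu, hτσ]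
  · intro u hu
    have hs : ψ₀ (σ u) ∈ φ.source := φ.map_target (hRV _ hu).2.1
    have hd : DifferentiableAt ℝ φ (ψ₀ (σ u)) :=
      (hφ.contDiffAt (φ.open_source.mem_nhds hs)).differentiableAt (by simp)
    have hτd : Differentiable ℝ τ := by fun_prop
    exact (hτd _).comp _ (π.differentiableAt.comp _ (hd.sub_const _))
  · have hc : ContinuousAt θ₀ x := hθ₀d.continuousAt
    have h1 : ∀ᶠ y in nhds x, θ₀ y ∈ Metric.ball (0 : Fin n → ℝ) r :=
      hc (by rw [hθ₀x]; exact Metric.ball_mem_nhds 0 hr0)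
    have h2 : ∀ᶠ y in nhds x, y ∈ φ.source := φ.open_source.mem_nhds hxs
    filter_upwards [nhdsWithin_le_nhds h1, nhdsWithin_le_nhds h2, self_mem_nhdsWithin]
      with y hy1 hy2 hyM
    refine ⟨τ (θ₀ y), fun i _ => ?_, ?_⟩
    · rw [mem_ball_zero_iff, pi_norm_lt_iff hr0] at hy1
      have hi := abs_lt.1 (hy1 i)
      simp only [hτ, Pi.smul_apply, Pi.add_apply, Pi.one_apply, smul_eq_mul, Set.mem_Ico]
      have h3 : r⁻¹ * r = 1 := inv_mul_cancel₀ hr0.ne'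
      have h4 : 0 < r⁻¹ := by positivity
      constructor <;> nlinarith
    · simp only [Function.comp_apply, hστ, hψ₀, hθ₀]
      rw [hιπ _ (W.sub_mem ((hMW y hy2).1 hyM) hφxW), add_sub_cancel, φ.left_inv hy2]

/-! ### Comparison of the volume of a submanifold with Lebesgue measure in a chart -/

section Comparison

open MeasureTheory

/-- The factor is really `c ^ (1 / q)`; as `c ≥ 1` it is at most `c`, uniformly in `q`. -/
theorem eLpNorm_le_mul_eLpNorm_of_le_smul {α F : Type*} [MeasurableSpace α] [NormedAddCommGroup F]
    {μ ν : Measure α} {c : ℝ≥0∞} (hc : 1 ≤ c) (h : μ ≤ c • ν) {q : ℝ≥0∞} (hq : 1 ≤ q)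
    (f : α → F) : eLpNorm f q μ ≤ c * eLpNorm f q ν := by
  refine (eLpNorm_mono_measure f h).trans ?_
  rw [eLpNorm_smul_measure_of_ne_zero (zero_lt_one.trans_le hc).ne', smul_eq_mul]
  gcongr
  refine (ENNReal.rpow_le_rpow_of_exponent_le (z := 1) hc ?_).trans_eq (ENNReal.rpow_one _)
  refine ENNReal.toReal_le_of_le_ofReal zero_le_one ?_
  simpa using hq

theorem eLpNorm_le_sum_eLpNorm_restrict {α F ι : Type*} [MeasurableSpace α] [NormedAddCommGroup F]
    [Fintype ι] {μ : Measure α} {A : ι → Set α} (hA : ∀ i, MeasurableSet (A i))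
    (hcov : ∀ᵐ x ∂μ, ∃ i, x ∈ A i) {f : α → F} (hf : AEStronglyMeasurable f μ) {q : ℝ≥0∞}
    (hq : 1 ≤ q) : eLpNorm f q μ ≤ ∑ i, eLpNorm f q (μ.restrict (A i)) := by
  calc eLpNorm f q μ ≤ eLpNorm (∑ i, (A i).indicator fun x => ‖f x‖) q μ := by
        refine eLpNorm_mono_ae_real ?_
        filter_upwards [hcov] with x ⟨i, hi⟩
        rw [Finset.sum_apply]
        refine le_trans ?_ (Finset.single_le_sum (fun j _ =>
          Set.indicator_nonneg (fun _ _ => norm_nonneg _) x) (Finset.mem_univ i))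
        rw [Set.indicator_of_mem hi]
    _ ≤ ∑ i, eLpNorm ((A i).indicator fun x => ‖f x‖) q μ :=
        eLpNorm_sum_le (fun i _ => hf.norm.indicator (hA i)) hq
    _ = _ := by
        refine Finset.sum_congr rfl fun i _ => ?_
        rw [eLpNorm_indicator_eq_eLpNorm_restrict (hA i), eLpNorm_norm]

namespace IsCubeChart

variable {m n : ℕ} {M : Set (EuclideanSpace ℝ (Fin m))} {L : NNReal} {U : Set (Fin n → ℝ)}
  {ψ : (Fin n → ℝ) → EuclideanSpace ℝ (Fin m)} {θ : EuclideanSpace ℝ (Fin m) → (Fin n → ℝ)}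

theorem unitCube_subset (h : IsCubeChart M L U ψ θ) : unitCube n ⊆ U :=
  (unitCube_subset_Icc n).trans h.Icc_subset

theorem measurableEmbedding (h : IsCubeChart M L U ψ θ) :
    MeasurableEmbedding ((unitCube n).domRestrict ψ) :=
  (h.contDiffOn.continuousOn.mono h.unitCube_subset).measurableEmbedding (measurableSet_unitCube n)
    (h.leftInvOn.injOn.mono h.unitCube_subset)

theorem measurableSet_image (h : IsCubeChart M L U ψ θ) : MeasurableSet (ψ '' unitCube n) := by
  rw [← Set.range_domRestrict]
  exact h.measurableEmbedding.measurableSet_range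

theorem map_comap_apply (h : IsCubeChart M L U ψ θ) (s : Set (EuclideanSpace ℝ (Fin m))) :
    ((volume : Measure (Fin n → ℝ)).comap ((↑) : unitCube n → Fin n → ℝ)).map
      ((unitCube n).domRestrict ψ) s = volume (unitCube n ∩ ψ ⁻¹' s) := by
  rw [h.measurableEmbedding.map_apply,
    (MeasurableEmbedding.subtype_coe (measurableSet_unitCube n)).comap_apply]
  congr 1
  ext u
  simp [Set.domRestrict, and_comm]

theorem eLpNorm_map {F : Type*} [NormedAddCommGroup F] (h : IsCubeChart M L U ψ θ)
    (f : EuclideanSpace ℝ (Fin m) → F) (q : ℝ≥0∞) :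
    eLpNorm f q (((volume : Measure (Fin n → ℝ)).comap ((↑) : unitCube n → Fin n → ℝ)).map
      ((unitCube n).domRestrict ψ)) = eLpNorm (f ∘ ψ) q (volume.restrict (unitCube n)) := by
  rw [h.measurableEmbedding.eLpNorm_map_measure, ← map_comap_subtype_coe (measurableSet_unitCube n),
    (MeasurableEmbedding.subtype_coe (measurableSet_unitCube n)).eLpNorm_map_measure]
  rfl

theorem volume_inter_preimage_le (h : IsCubeChart M L U ψ θ) (s : Set (EuclideanSpace ℝ (Fin m))) :
    volume (unitCube n ∩ ψ ⁻¹' s) ≤ (L : ℝ≥0∞) ^ n * μH[n] (M ∩ s) := by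
  have hsub : ψ '' (unitCube n ∩ ψ ⁻¹' s) ⊆ M ∩ s := by
    rintro _ ⟨u, hu, rfl⟩
    exact ⟨h.mapsTo (h.unitCube_subset hu.1), hu.2⟩
  have himg : θ '' (ψ '' (unitCube n ∩ ψ ⁻¹' s)) = unitCube n ∩ ψ ⁻¹' s :=
    (h.leftInvOn.mono (Set.inter_subset_left.trans h.unitCube_subset)).image_image
  have hle := (h.lipschitz_inv.mono (Set.image_mono
    (Set.inter_subset_left.trans h.unitCube_subset))).hausdorffMeasure_image_le
      (s := ψ '' (unitCube n ∩ ψ ⁻¹' s)) (d := n) (by positivity)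
  have hv := hausdorffMeasure_pi_real (ι := Fin n)
  rw [Fintype.card_fin] at hv
  rw [himg, hv, ENNReal.rpow_natCast] at hle
  refine hle.trans ?_
  gcongr

theorem hausdorffMeasure_inter_image_le (h : IsCubeChart M L U ψ θ)
    (s : Set (EuclideanSpace ℝ (Fin m))) :
    μH[n] (s ∩ ψ '' unitCube n) ≤ (L : ℝ≥0∞) ^ n * volume (unitCube n ∩ ψ ⁻¹' s) := by
  have himg : s ∩ ψ '' unitCube n = ψ '' (unitCube n ∩ ψ ⁻¹' s) := by
    rw [Set.image_inter_preimage, Set.inter_comm]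
  have hle := (h.lipschitz.mono
    (Set.inter_subset_left.trans h.unitCube_subset)).hausdorffMeasure_image_le
      (s := unitCube n ∩ ψ ⁻¹' s) (d := n) (by positivity)
  have hv := hausdorffMeasure_pi_real (ι := Fin n)
  rw [Fintype.card_fin] at hv
  rwa [hv, ENNReal.rpow_natCast, ← himg] at hle

/-- Bi-Lipschitz charts distort `n`-dimensional Hausdorff measure by at most `L ^ n`, so no area
formula is needed. The factor `κ` converts between the two normalizations of that measure. -/
theorem exists_eLpNorm_comparison (h : IsCubeChart M L U ψ θ) :
    ∃ C : NNReal, ∀ q : ℝ≥0∞, 1 ≤ q → ∀ (F : Type) [NormedAddCommGroup F]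
      (f : EuclideanSpace ℝ (Fin m) → F),
      eLpNorm (f ∘ ψ) q (volume.restrict (unitCube n)) ≤ C * eLpNorm f q (volumeMeasure n M) ∧
      eLpNorm f q ((volumeMeasure n M).restrict (ψ '' unitCube n)) ≤
        C * eLpNorm (f ∘ ψ) q (volume.restrict (unitCube n)) := by
  set κ := Measure.addHaarScalarFactor (volume : Measure (EuclideanSpace ℝ (Fin n))) μH[n] with hκ
  have hκ0 : κ ≠ 0 := Measure.addHaarScalarFactor_volume_hausdorffMeasure_ne_zero n
  have hvol : ∀ s : Set (EuclideanSpace ℝ (Fin m)), (μHE[n]) s = (κ : ℝ≥0∞) * μH[n] s := by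
    intro s
    rw [Measure.euclideanHausdorffMeasure_def]
    rfl
  set C : NNReal := max 1 (max (κ⁻¹ * L ^ n) (κ * L ^ n)) with hC
  have hC1 : (1 : ℝ≥0∞) ≤ C := by exact_mod_cast le_max_left _ _
  have hC2 : ((κ : ℝ≥0∞)⁻¹ * (L : ℝ≥0∞) ^ n) ≤ C := by
    rw [← ENNReal.coe_inv hκ0]
    exact_mod_cast (le_max_left _ _).trans (le_max_right _ _)
  have hC3 : ((κ : ℝ≥0∞) * (L : ℝ≥0∞) ^ n) ≤ C := by
    exact_mod_cast (le_max_right _ _).trans (le_max_right _ _)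
  refine ⟨C, fun q hq F _ f => ⟨?_, ?_⟩⟩
  · rw [← h.eLpNorm_map]
    refine eLpNorm_le_mul_eLpNorm_of_le_smul hC1 (Measure.le_iff.2 fun s hs => ?_) hq f
    rw [h.map_comap_apply, Measure.smul_apply, volumeMeasure, Measure.restrict_apply hs, hvol,
      smul_eq_mul]
    calc _ ≤ (L : ℝ≥0∞) ^ n * μH[n] (M ∩ s) := h.volume_inter_preimage_le s
      _ = ((κ : ℝ≥0∞)⁻¹ * (L : ℝ≥0∞) ^ n) * (κ * μH[n] (s ∩ M)) := by
          rw [mul_mul_mul_comm, ENNReal.inv_mul_cancel (by exact_mod_cast hκ0) (by simp), one_mul,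
            Set.inter_comm]
      _ ≤ _ := by gcongr
  · rw [← h.eLpNorm_map]
    refine eLpNorm_le_mul_eLpNorm_of_le_smul hC1 (Measure.le_iff.2 fun s hs => ?_) hq f
    rw [Measure.smul_apply, h.map_comap_apply, Measure.restrict_apply hs, volumeMeasure,
      smul_eq_mul]
    calc _ ≤ (μHE[n]) (s ∩ ψ '' unitCube n) := Measure.restrict_apply_le _ _
      _ ≤ (κ : ℝ≥0∞) * ((L : ℝ≥0∞) ^ n * volume (unitCube n ∩ ψ ⁻¹' s)) := by
          rw [hvol]
          gcongr
          exact h.hausdorffMeasure_inter_image_le s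
      _ ≤ _ := by rw [← mul_assoc]; gcongr

end IsCubeChart

end Comparison

/-! ### Tangential gradients in a chart -/

section Gradient

theorem contDiff_polyFun {m : ℕ} (p : MvPolynomial (Fin m) ℝ) : ContDiff ℝ 1 (polyFun p) := by
  unfold polyFun
  induction p using MvPolynomial.induction_on with
  | C a => simpa using contDiff_const
  | add p q hp hq => simpa using hp.add hq
  | mul_X p i hp =>
    simp only [map_mul, MvPolynomial.eval_X]
    exact hp.mul (by fun_prop)

namespace IsCubeChart

variable {m n : ℕ} {M : Set (EuclideanSpace ℝ (Fin m))} {L : NNReal} {U : Set (Fin n → ℝ)}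
  {ψ : (Fin n → ℝ) → EuclideanSpace ℝ (Fin m)} {θ : EuclideanSpace ℝ (Fin m) → (Fin n → ℝ)}

theorem differentiableAt (h : IsCubeChart M L U ψ θ) {u : Fin n → ℝ} (hu : u ∈ U) :
    DifferentiableAt ℝ ψ u :=
  (h.contDiffOn.contDiffAt (h.isOpen.mem_nhds hu)).differentiableAt one_ne_zero

theorem fderiv_mem_tangentSpaceAt (h : IsCubeChart M L U ψ θ) {u : Fin n → ℝ} (hu : u ∈ U)
    (v : Fin n → ℝ) : fderiv ℝ ψ u v ∈ tangentSpaceAt M (ψ u) := by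
  refine Submodule.subset_span ⟨fun t => ψ (u + t • v), by simp, ?_, ?_⟩
  · have hc : ContinuousAt (fun t : ℝ => u + t • v) 0 := by fun_prop
    have : ∀ᶠ t in nhds (0 : ℝ), u + t • v ∈ U :=
      hc (h.isOpen.mem_nhds (by simpa using hu))
    exact this.mono fun t ht => h.mapsTo ht
  · have h1 : HasDerivAt (fun t : ℝ => u + t • v) v 0 := by
      simpa using ((hasDerivAt_id (0 : ℝ)).smul_const v).const_add u
    have h2 : HasFDerivAt ψ (fderiv ℝ ψ u) (u + (0 : ℝ) • v) := by
      simpa using (h.differentiableAt hu).hasFDerivAt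
    exact h2.comp_hasDerivAt 0 h1

/-- The derivative of `p ∘ ψ` pairs the gradient only with vectors tangent to `M`, so the gradient
may be replaced by its projection. -/
theorem norm_fderiv_polyFun_comp_le (h : IsCubeChart M L U ψ θ) (p : MvPolynomial (Fin m) ℝ)
    {u : Fin n → ℝ} (hu : u ∈ U) :
    ‖fderiv ℝ (polyFun p ∘ ψ) u‖ ≤ L * ‖tangentialGradient M p (ψ u)‖ := by
  have hp : DifferentiableAt ℝ (polyFun p) (ψ u) :=
    (contDiff_polyFun p).differentiable one_ne_zero _
  have hL : ‖fderiv ℝ ψ u‖ ≤ L :=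
    norm_fderiv_le_of_lipschitzOn ℝ (h.isOpen.mem_nhds hu) h.lipschitz
  refine ContinuousLinearMap.opNorm_le_bound _ (by positivity) fun v => ?_
  have e : fderiv ℝ (polyFun p ∘ ψ) u v =
      inner ℝ (tangentialGradient M p (ψ u)) (fderiv ℝ ψ u v) := by
    rw [fderiv_comp u hp (h.differentiableAt hu), ContinuousLinearMap.comp_apply,
      tangentialGradient, Submodule.inner_starProjection_left_eq_right,
      Submodule.starProjection_eq_self_iff.2 (h.fderiv_mem_tangentSpaceAt hu v),
      gradient, InnerProductSpace.toDual_symm_apply]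
  rw [e]
  refine (norm_inner_le_norm _ _).trans ?_
  rw [mul_comm (L : ℝ), mul_assoc]
  gcongr
  exact (ContinuousLinearMap.le_opNorm _ _).trans (by gcongr)

end IsCubeChart

end Gradient

/-! ### A Poincaré inequality for polynomials on a compact submanifold -/

section Submanifold

open MeasureTheory

variable {m n : ℕ} {M : Set (EuclideanSpace ℝ (Fin m))}

theorem IsCubeChart.contDiffOn_polyFun_comp {L : NNReal} {U : Set (Fin n → ℝ)}
    {ψ : (Fin n → ℝ) → EuclideanSpace ℝ (Fin m)} {θ : EuclideanSpace ℝ (Fin m) → (Fin n → ℝ)}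
    (h : IsCubeChart M L U ψ θ) (p : MvPolynomial (Fin m) ℝ) :
    ContDiffOn ℝ 1 (polyFun p ∘ ψ) U :=
  (contDiff_polyFun p).comp_contDiffOn h.contDiffOn

/-- A finite family of cubical charts that covers `M`. -/
structure CubeAtlas (n : ℕ) (M : Set (EuclideanSpace ℝ (Fin m))) where
  card : ℕ
  L : Fin card → NNReal
  U : Fin card → Set (Fin n → ℝ)
  ψ : Fin card → (Fin n → ℝ) → EuclideanSpace ℝ (Fin m)
  θ : Fin card → EuclideanSpace ℝ (Fin m) → (Fin n → ℝ)
  isCubeChart : ∀ i, IsCubeChart M (L i) (U i) (ψ i) (θ i)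
  cover : ∀ x ∈ M, ∃ i, x ∈ ψ i '' unitCube n

theorem nonempty_cubeAtlas (hM : IsSmoothSubmanifold n M) (hc : IsCompact M) :
    Nonempty (CubeAtlas n M) := by
  choose! L U ψ θ hψ hn using fun x (hx : x ∈ M) => exists_isCubeChart hM hx
  obtain ⟨t, htM, ht⟩ := hc.elim_nhdsWithin_subcover (fun x => ψ x '' unitCube n) hn
  refine ⟨⟨t.card, fun i => L (t.equivFin.symm i), fun i => U (t.equivFin.symm i),
    fun i => ψ (t.equivFin.symm i), fun i => θ (t.equivFin.symm i),
    fun i => hψ _ (htM _ (t.equivFin.symm i).2), fun x hx => ?_⟩⟩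
  obtain ⟨y, hy, hxy⟩ := Set.mem_iUnion₂.1 (ht hx)
  exact ⟨t.equivFin ⟨y, hy⟩, by simpa using hxy⟩

namespace CubeAtlas

/-- The integrals of a polynomial over the cells of the `N`-th grid in each chart. -/
noncomputable def gridIntegrals (𝒜 : CubeAtlas n M) (N : ℕ) (hN : 0 < N) :
    MvPolynomial (Fin m) ℝ →ₗ[ℝ] (Fin 𝒜.card × (Fin n → Fin N) → ℝ) where
  toFun p w := ∫ x in gridCell N w.2, polyFun p (𝒜.ψ w.1 x)
  map_add' p q := by
    have hi : ∀ (p : MvPolynomial (Fin m) ℝ) (w : Fin 𝒜.card × (Fin n → Fin N)),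
        IntegrableOn (fun x => polyFun p (𝒜.ψ w.1 x)) (gridCell N w.2) := fun p w =>
      ((((𝒜.isCubeChart w.1).contDiffOn_polyFun_comp p).continuousOn.mono
        (𝒜.isCubeChart w.1).Icc_subset).integrableOn_compact isCompact_Icc).mono_set
        (((Set.subset_iUnion _ w.2).trans (iUnion_gridCell hN).subset).trans
          (unitCube_subset_Icc n))
    funext w
    rw [Pi.add_apply, ← integral_add (hi p w) (hi q w)]
    simp [polyFun]
  map_smul' a p := by
    funext w
    rw [Pi.smul_apply, RingHom.id_apply, ← integral_smul]
    simp [polyFun]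

theorem eLpNorm_polyFun_le_sum (𝒜 : CubeAtlas n M) :
    ∃ C : NNReal, ∀ q : ℝ≥0∞, 1 ≤ q → ∀ p : MvPolynomial (Fin m) ℝ,
      eLpNorm (polyFun p) q (volumeMeasure n M) ≤
        ∑ i, C * eLpNorm (polyFun p ∘ 𝒜.ψ i) q (volume.restrict (unitCube n)) := by
  choose C hC using fun i => (𝒜.isCubeChart i).exists_eLpNorm_comparison
  refine ⟨∑ i, C i, fun q hq p => ?_⟩
  refine (eLpNorm_le_sum_eLpNorm_restrict (fun i => (𝒜.isCubeChart i).measurableSet_image) ?_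
    (contDiff_polyFun p).continuous.aestronglyMeasurable hq).trans
    (Finset.sum_le_sum fun i _ => (hC i q hq ℝ (polyFun p)).2.trans ?_)
  · have hms : MeasurableSet {x | ∃ i, x ∈ 𝒜.ψ i '' unitCube n} := by
      have : {x | ∃ i, x ∈ 𝒜.ψ i '' unitCube n} = ⋃ i, 𝒜.ψ i '' unitCube n := by
        ext; simp
      rw [this]
      exact MeasurableSet.iUnion fun i => (𝒜.isCubeChart i).measurableSet_image
    rw [volumeMeasure, ae_restrict_iff hms]
    exact Filter.Eventually.of_forall 𝒜.cover
  · gcongr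
    exact_mod_cast Finset.single_le_sum (fun _ _ => zero_le) (Finset.mem_univ i)

theorem eLpNorm_polyFun_lt_top (𝒜 : CubeAtlas n M) {q : ℝ≥0∞} (hq : 1 ≤ q)
    (p : MvPolynomial (Fin m) ℝ) : eLpNorm (polyFun p) q (volumeMeasure n M) < ⊤ := by
  obtain ⟨C, hC⟩ := 𝒜.eLpNorm_polyFun_le_sum
  refine (hC q hq p).trans_lt (ENNReal.sum_lt_top.2 fun i _ =>
    ENNReal.mul_lt_top ENNReal.coe_lt_top ?_)
  have hcont := ((𝒜.isCubeChart i).contDiffOn_polyFun_comp p).continuousOn.mono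
    (𝒜.isCubeChart i).Icc_subset
  obtain ⟨B, hB⟩ := isCompact_Icc.exists_bound_of_continuousOn hcont
  have hfin : IsFiniteMeasure (volume.restrict (Set.Icc (0 : Fin n → ℝ) 1)) :=
    ⟨by simpa using isCompact_Icc.measure_lt_top⟩
  refine (eLpNorm_mono_measure _ (Measure.restrict_mono (unitCube_subset_Icc n) le_rfl)).trans_lt ?_
  exact (MemLp.of_bound (hcont.aestronglyMeasurable measurableSet_Icc) B
    ((ae_restrict_mem measurableSet_Icc).mono hB)).2

/-- A continuous function vanishing almost everywhere on the cube vanishes on all of it, because the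
cube lies in the closure of its interior. -/
theorem polyFun_eq_zero_of_eLpNorm_eq_zero (𝒜 : CubeAtlas n M) {q : ℝ≥0∞} (hq : 1 ≤ q)
    {p : MvPolynomial (Fin m) ℝ} (h : eLpNorm (polyFun p) q (volumeMeasure n M) = 0) :
    ∀ x ∈ M, polyFun p x = 0 := by
  intro x hx
  obtain ⟨i, u, hu, rfl⟩ := 𝒜.cover x hx
  have hi := 𝒜.isCubeChart i
  obtain ⟨C, hC⟩ := hi.exists_eLpNorm_comparison
  have h0 : eLpNorm (polyFun p ∘ 𝒜.ψ i) q (volume.restrict (unitCube n)) = 0 := by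
    have := (hC q hq ℝ (polyFun p)).1
    rwa [h, mul_zero, nonpos_iff_eq_zero] at this
  have hcont := (hi.contDiffOn_polyFun_comp p).continuousOn.mono hi.unitCube_subset
  rw [eLpNorm_eq_zero_iff (hcont.aestronglyMeasurable (measurableSet_unitCube n))
    (zero_lt_one.trans_le hq).ne'] at h0
  refine Measure.eqOn_of_ae_eq h0 hcont continuousOn_const ?_ hu
  rw [unitCube, interior_pi_set Set.finite_univ]
  simp only [interior_Ico, closure_pi_set, closure_Ioo zero_ne_one]
  exact Set.pi_mono fun _ _ => Set.Ico_subset_Icc_self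

theorem eLpNorm_polyFun_le_of_gridIntegrals_eq_zero (𝒜 : CubeAtlas n M) :
    ∃ K : NNReal, ∀ (N : ℕ) (hN : 0 < N) (q : ℝ≥0∞), 1 ≤ q → ∀ p : MvPolynomial (Fin m) ℝ,
      𝒜.gridIntegrals N hN p = 0 →
      eLpNorm (polyFun p) q (volumeMeasure n M) ≤
        K * ENNReal.ofReal (1 / N) * eLpNorm (tangentialGradient M p) q (volumeMeasure n M) := by
  obtain ⟨C, hC⟩ := 𝒜.eLpNorm_polyFun_le_sum
  choose D hD using fun i => (𝒜.isCubeChart i).exists_eLpNorm_comparison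
  refine ⟨∑ i, C * (2 ^ n * (𝒜.L i * D i)), fun N hN q hq p hp => (hC q hq p).trans ?_⟩
  have hi : ∀ i, eLpNorm (polyFun p ∘ 𝒜.ψ i) q (volume.restrict (unitCube n)) ≤
      2 ^ n * ENNReal.ofReal (1 / N) *
        (𝒜.L i * (D i * eLpNorm (tangentialGradient M p) q (volumeMeasure n M))) := by
    intro i
    have hc := 𝒜.isCubeChart i
    refine (eLpNorm_unitCube_le_of_integral_gridCell_eq_zero hN hc.isOpen hc.Icc_subset
      (hc.contDiffOn_polyFun_comp p) (fun j => congrFun hp (i, j)) hq).trans ?_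
    gcongr
    refine le_trans ?_ (mul_le_mul' le_rfl (hD i q hq _ (tangentialGradient M p)).1)
    refine eLpNorm_le_nnreal_smul_eLpNorm_of_ae_le_mul ?_ q
    filter_upwards [ae_restrict_mem (measurableSet_unitCube n)] with u hu
    exact hc.norm_fderiv_polyFun_comp_le p (hc.unitCube_subset hu)
  refine (Finset.sum_le_sum fun i _ => mul_le_mul' le_rfl (hi i)).trans_eq ?_
  push_cast
  rw [Finset.sum_mul, Finset.sum_mul]
  exact Finset.sum_congr rfl fun i _ => by ring

end CubeAtlas

/-! ### The ideal of a submanifold -/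

/-- Passing to the Zariski closure does not change the ideal, so both bounds can be proved with
polynomials vanishing on `M`. -/
theorem mem_vanishingIdeal_zariskiClosure {p : MvPolynomial (Fin m) ℝ} :
    p ∈ MvPolynomial.vanishingIdeal ℝ ((WithLp.ofLp (p := 2)) '' zariskiClosure M) ↔
      ∀ x ∈ M, polyFun p x = 0 := by
  rw [MvPolynomial.mem_vanishingIdeal_iff, Set.forall_mem_image]
  simp only [MvPolynomial.aeval_eq_eval]
  exact ⟨fun h x hx => h fun q hq => hq x hx, fun h x hx => hx p h⟩

theorem finrank_map_le_of_ker_le {k V V₁ V₂ : Type*} [Field k] [AddCommGroup V] [Module k V]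
    [AddCommGroup V₁] [Module k V₁] [AddCommGroup V₂] [Module k V₂] [FiniteDimensional k V₂]
    (P : Submodule k V) [FiniteDimensional k P] (f : V →ₗ[k] V₁) (g : V →ₗ[k] V₂)
    (h : ∀ p ∈ P, g p = 0 → f p = 0) :
    Module.finrank k (P.map f) ≤ Module.finrank k V₂ := by
  have hker : LinearMap.ker (g.domRestrict P) ≤ LinearMap.ker (f.domRestrict P) := fun p hp =>
    h p p.2 hp
  have h1 := LinearMap.finrank_range_add_finrank_ker (g.domRestrict P)
  have h2 := LinearMap.finrank_range_add_finrank_ker (f.domRestrict P)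
  have h3 := Submodule.finrank_mono hker
  have h4 := Submodule.finrank_le (LinearMap.range (g.domRestrict P))
  rw [LinearMap.range_domRestrict] at h2
  omega

theorem ringKrullDim_le_of_bernsteinInequality (𝒜 : CubeAtlas n M) {q : ℝ≥0∞} (hq : 1 ≤ q)
    {C : ℝ} (hC : 0 < C) (hB : BernsteinInequality n M q C) {I : Ideal (MvPolynomial (Fin m) ℝ)}
    (hI : ∀ p : MvPolynomial (Fin m) ℝ, (∀ x ∈ M, polyFun p x = 0) → p ∈ I) :
    ringKrullDim (MvPolynomial (Fin m) ℝ ⧸ I) ≤ n := by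
  obtain ⟨K, hK⟩ := 𝒜.eLpNorm_polyFun_le_of_gridIntegrals_eq_zero
  obtain ⟨A, hA⟩ := exists_nat_gt (2 * (K * C))
  have hA0 : (0 : ℝ) < A := lt_of_le_of_lt (by positivity) hA
  refine ringKrullDim_quotient_le_of_finrank_le (A := 𝒜.card * A ^ n) I fun k hk => ?_
  have hN : 0 < A * k := Nat.mul_pos (by exact_mod_cast hA0) hk
  have hk0 : (0 : ℝ) < k := by exact_mod_cast hk
  refine (finrank_map_le_of_ker_le _ (Ideal.Quotient.mkₐ ℝ I).toLinearMap
    (𝒜.gridIntegrals (A * k) hN) fun p hp hp0 => ?_).trans ?_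
  · rw [MvPolynomial.mem_restrictTotalDegree] at hp
    refine Ideal.Quotient.eq_zero_iff_mem.2 (hI p
      (𝒜.polyFun_eq_zero_of_eLpNorm_eq_zero hq ?_))
    set x := eLpNorm (polyFun p) q (volumeMeasure n M)
    have hxt : x ≠ ⊤ := (𝒜.eLpNorm_polyFun_lt_top hq p).ne
    have hx : x ≤ ENNReal.ofReal (1 / 2) * x := by
      refine (hK (A * k) hN q hq p hp0).trans ?_
      refine (mul_le_mul' le_rfl (hB p)).trans ?_
      rw [← mul_assoc, ← ENNReal.ofReal_coe_nnreal (p := K),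
        ← ENNReal.ofReal_mul (by positivity), ← ENNReal.ofReal_mul (by positivity)]
      gcongr
      have hd : (p.totalDegree : ℝ) ≤ k := by exact_mod_cast hp
      calc (K : ℝ) * (1 / ((A * k : ℕ) : ℝ)) * (C * p.totalDegree)
          ≤ K * (1 / ((A * k : ℕ) : ℝ)) * (C * k) := by gcongr
        _ = (K * C) / A := by push_cast; field_simp
        _ ≤ 1 / 2 := by rw [div_le_div_iff₀ hA0 two_pos]; linarith
    -- The norm is finite, so `x ≤ x / 2` forces `x = 0`.
    by_contra hx0
    have h1 : ENNReal.ofReal (1 / 2) * x < 1 * x := by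
      rw [ENNReal.mul_lt_mul_iff_left hx0 hxt]
      rw [ENNReal.ofReal_lt_one]
      norm_num
    rw [one_mul] at h1
    exact absurd hx h1.not_ge
  · simp only [Module.finrank_fintype_fun_eq_card, Fintype.card_prod, Fintype.card_fin,
      Fintype.card_fun]
    rw [mul_pow, mul_assoc]

theorem le_ringKrullDim_of_isCubeChart {L : NNReal} {U : Set (Fin n → ℝ)}
    {ψ : (Fin n → ℝ) → EuclideanSpace ℝ (Fin m)} {θ : EuclideanSpace ℝ (Fin m) → (Fin n → ℝ)}
    (h : IsCubeChart M L U ψ θ) {I : Ideal (MvPolynomial (Fin m) ℝ)}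
    (hI : ∀ p ∈ I, ∀ x ∈ M, polyFun p x = 0) :
    (n : WithBot ℕ∞) ≤ ringKrullDim (MvPolynomial (Fin m) ℝ ⧸ I) := by
  have hu : (0 : Fin n → ℝ) ∈ U := h.Icc_subset ⟨le_rfl, zero_le_one⟩
  set T := fderiv ℝ θ (ψ 0) with hT
  -- Chain rule for `θ ∘ ψ = id` near the corner `0` of the cube, which is interior to `U`.
  have hcomp : T ∘L fderiv ℝ ψ 0 = ContinuousLinearMap.id ℝ _ := by
    rw [hT, ← fderiv_comp 0 (h.differentiableAt_inv 0 hu) (h.differentiableAt hu), ← fderiv_id]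
    refine Filter.EventuallyEq.fderiv_eq ?_
    filter_upwards [h.isOpen.mem_nhds hu] with u hu'
    exact h.leftInvOn hu'
  have hstrict : HasStrictFDerivAt (fun u => T (ψ u)) (T ∘L fderiv ℝ ψ 0) 0 :=
    T.hasStrictFDerivAt.comp 0
      ((h.contDiffOn.contDiffAt (h.isOpen.mem_nhds hu)).hasStrictFDerivAt one_ne_zero)
  -- Since `T ∘ ψ` has invertible strict derivative at `0`, its image contains a ball.
  have himg : (fun u => T (ψ u)) '' U ∈ nhds (T (ψ 0)) := by
    rw [← hstrict.map_nhds_eq_of_surj (by rw [hcomp]; exact LinearMap.range_id)]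
    exact Filter.image_mem_map (h.isOpen.mem_nhds hu)
  obtain ⟨ε, hε, hball⟩ := Metric.mem_nhds_iff.1 himg
  set l : Fin n → MvPolynomial (Fin m) ℝ := fun i =>
    ∑ j, MvPolynomial.C (T (EuclideanSpace.single j 1) i) * MvPolynomial.X j with hl
  have hlT : ∀ (y : EuclideanSpace ℝ (Fin m)) (i : Fin n),
      MvPolynomial.eval (fun i => y i) (l i) = T y i := by
    intro y i
    conv_rhs => rw [← (EuclideanSpace.basisFun (Fin m) ℝ).sum_repr y]
    simp [hl, mul_comm]
  refine le_ringKrullDim_of_injective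
    ((Ideal.Quotient.mkₐ ℝ I).comp (MvPolynomial.aeval l)) ?_
  refine (injective_iff_map_eq_zero _).2 fun P hP => ?_
  have hPI : ∀ x ∈ M, polyFun (MvPolynomial.aeval l P) x = 0 :=
    hI _ (Ideal.Quotient.eq_zero_iff_mem.1 hP)
  -- A sup-norm ball is a product of intervals, and a polynomial vanishing on a product of infinite
  -- sets is zero.
  refine MvPolynomial.funext_set (fun i => Metric.ball (T (ψ 0) i) ε) (fun i => ?_) fun z hz => ?_
  · rw [Real.ball_eq_Ioo]
    exact Set.Ioo_infinite (by linarith)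
  · rw [← ball_pi _ hε] at hz
    obtain ⟨u, hu', rfl⟩ := hball hz
    have := hPI (ψ u) (h.mapsTo hu')
    rw [polyFun, ← MvPolynomial.aeval_eq_eval, ← AlgHom.comp_apply, MvPolynomial.comp_aeval] at this
    simp only [MvPolynomial.aeval_eq_eval, hlT] at this
    simpa using this

end Submanifold

end TangentialBernstein

theorem mainTheorem8 (m n : ℕ) (M : Set (EuclideanSpace ℝ (Fin m)))
    (hne : M.Nonempty) (hcompact : IsCompact M)
    (hM : TangentialBernstein.IsSmoothSubmanifold n M)
    (hB : ∃ q : ℝ≥0∞, 1 ≤ q ∧ ∃ C : ℝ, 0 < C ∧ TangentialBernstein.BernsteinInequality n M q C) :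
    TangentialBernstein.IsAlgebraicSubmanifold n M := by
  obtain ⟨q, hq, C, hC, hBC⟩ := hB
  obtain ⟨𝒜⟩ := TangentialBernstein.nonempty_cubeAtlas hM hcompact
  obtain ⟨x, hx⟩ := hne
  obtain ⟨i, -⟩ := 𝒜.cover x hx
  exact le_antisymm
    (TangentialBernstein.ringKrullDim_le_of_bernsteinInequality 𝒜 hq hC hBC fun _ hp =>
      TangentialBernstein.mem_vanishingIdeal_zariskiClosure.2 hp)
    (TangentialBernstein.le_ringKrullDim_of_isCubeChart (𝒜.isCubeChart i) fun _ hp =>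
      TangentialBernstein.mem_vanishingIdeal_zariskiClosure.1 hp)
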